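/- Fix complex numbers $s,q$. For $u\in\mathbb C$ and $g\in\mathbb Z_{\ge 0}$ define the vertex weights $$w_u(g,0;g,0)=\frac{1-sq^gu}{1-su},\quad w_u(g+1,0;g,1)=\frac{(1-s^2q^g)u}{1-su},\quad w_u(g,1;g,1)=\frac{u-sq^g}{1-su},\quad w_u(g,1;g+1,0)=\frac{1-q^{g+1}}{1-su},$$ and $w_u(i_1,j_1;i_2,j_2)=0$ in all other cases; here $i_1,j_1$ (resp. $i_2,j_2$) are the numbers of paths entering a vertex from below and from the left (resp. leaving it through the top and to the right). For integers $\lambda_1\ge\dots\ge\lambda_n\ge 0$ let $\mathcal P_\lambda$ be the finite set of collections $\omega$ of $n$ up-right paths in $\mathbb Z_{\ge 0}\times\{1,\dots,n\}$ that start with the horizontal edges $(-1,y)\to(0,y)$, $1\le y\le n$, and end with the vertical edges $(\lambda_i,n)\to(\lambda_i,n+1)$, $1\le i\le n$, a collection being determined by the number of paths through each edge. With $\omega(x,y)$ the quadruple $(i_1,j_1;i_2,j_2)$ of $\omega$ at the vertex $(x,y)$, put $$\mathsf F_\lambda(u_1,\dots,u_n)=\sum_{\omega\in\mathcal P_\lambda}\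 \prod_{x=0}^{\infty}\prod_{y=1}^{n}w_{u_y}(\omega(x,y)).$$ This is a symmetric rational function of $u_1,\dots,u_n$. Put $F_k:=\mathsf F_{(k-1,k-2,\dots,0)}$ and $F_k(S):=F_k(s,\dots,s)$. For $1\le k\le m$ and $M=\{1,\dots,m\}$ define the operator $D_m^k$ on functions of $m$ variables by $$D_m^k=\sum_{I\subset M:\,|I|=k}\ \prod_{i\in I,\,j\notin I}\frac{u_j-qu_i}{u_j-u_i}\ \prod_{j\notin I}\left(\frac{u_j-s}{u_j-sq}\right)^k\frac{F_k(u_I)}{F_k(S)}\prod_{i\in I}T_{u_i,s},$$ where $F_k(u_I)$ is $F_k$ evaluated at the variables $u_i$, $i\in I$, and $T_{u_i,s}$ substitutes $u_i=s$. **Lemma 3.3.** Let $1\le k\le m$ and let $\lambda_1>\lambda_2>\dots>\lambda_m\ge 0$ be integers. Then $$D_m^k\,\mathsf F_\lambda(u_1,\dots,u_m)=\mathbf 1_{\{\lambda_m=0,\ \lambda_{m-1}=1,\ \dots,\ \lambda_{m-k+1}=k-1\}}\ \mathsf F_\lambda(u_1,\dots,u_m)$$ for all complex $s,q,u_1,\dots,u_m$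 for which the denominators above do not vanish, namely: $s^2\ne 1$, $q\neq 1$, $s\ne 0$ unless $k=1$, the $u_i$ are pairwise distinct, $su_i\ne 1$ for all $i$, and, if $k<m$, $u_i\ne sq$ for all $i$. -/

import Mathlib

noncomputable section

namespace SixVertex

/-- The vertex weight `w_u(i₁, j₁; i₂, j₂)` with parameters `s, q`: `i₁` arrows enter from below,
`j₁` from the left, `i₂` arrows leave through the top and `j₂` to the right. -/
def vertexWeight (s q u : ℂ) : ℕ → ℕ → ℕ → ℕ → ℂ
  | i₁, 0, i₂, 0 => if i₁ = i₂ then (1 - s * q ^ i₁ * u) / (1 - s * u) else 0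
  | i₁, 0, i₂, 1 => if i₁ = i₂ + 1 then (1 - s ^ 2 * q ^ i₂) * u / (1 - s * u) else 0
  | i₁, 1, i₂, 1 => if i₁ = i₂ then (u - s * q ^ i₁) / (1 - s * u) else 0
  | i₁, 1, i₂, 0 => if i₂ = i₁ + 1 then (1 - q ^ (i₁ + 1)) / (1 - s * u) else 0
  | _, _, _, _ => 0

/-- The multiplicity of the part `x` in `lam`. -/
def mult {n : ℕ} (lam : Fin n → ℕ) (x : ℕ) : ℕ :=
  (Finset.univ.filter fun i => lam i = x).card

/-- A collection of up-right paths in `ℤ_{≥ 0} × {1, …, n}`, recorded by the number of paths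
through each edge. The row `y : Fin n` is the row of height `y + 1`.
No path enters from below, one path enters each row from the left, and the paths leave
through the top at the columns `lam 0, …, lam (n - 1)`. -/
@[ext]
structure PathConfig {n : ℕ} (lam : Fin n → ℕ) where
  /-- `V x y` is the number of paths using the vertical edge `(x, y) → (x, y + 1)`. -/
  V : ℕ → Fin (n + 1) → ℕ
  /-- `H x y` is the number of paths using the horizontal edge `(x - 1, y + 1) → (x, y + 1)`. -/
  H : ℕ → Fin n → ℕ
  left : ∀ y, H 0 y = 1
  bottom : ∀ x, V x 0 = 0
  top : ∀ x, V x (Fin.last n) = mult lam x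
  conservation : ∀ x y, V x y.castSucc + H x y = V x y.succ + H (x + 1) y

namespace PathConfig

variable {n : ℕ} {lam : Fin n → ℕ}

/-- The weight of a path collection with spectral parameter `u y` in the row `y`. -/
def weight (s q : ℂ) (u : Fin n → ℂ) (ω : PathConfig lam) : ℂ :=
  ∏ᶠ x : ℕ, ∏ y : Fin n,
    vertexWeight s q (u y) (ω.V x y.castSucc) (ω.H x y) (ω.V x y.succ) (ω.H (x + 1) y)

lemma sum_H (ω : PathConfig lam) (X : ℕ) :
    ∑ y, ω.H X y = (Finset.univ.filter fun i => X ≤ lam i).card := by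
  induction X with
  | zero => simp [ω.left]
  | succ X ih =>
    have h1 : ∑ y, (ω.V X (Fin.castSucc y) + ω.H X y)
        = ∑ y, (ω.V X (Fin.succ y) + ω.H (X + 1) y) :=
      Finset.sum_congr rfl fun y _ => ω.conservation X y
    have h2 := Fin.sum_univ_castSucc (ω.V X)
    have h3 := Fin.sum_univ_succ (ω.V X)
    rw [ω.top] at h2
    rw [ω.bottom] at h3
    rw [Finset.sum_add_distrib, Finset.sum_add_distrib, ih] at h1
    have h4 : (Finset.univ.filter fun i => X ≤ lam i).card
        = mult lam X + (Finset.univ.filter fun i => X + 1 ≤ lam i).card := by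
      unfold mult
      rw [← Finset.card_union_of_disjoint]
      · congr 1
        ext i
        simp only [Finset.mem_filter, Finset.mem_union, Finset.mem_univ, true_and]
        omega
      · rw [Finset.disjoint_filter]
        intro i _ h
        omega
    omega

lemma H_le (ω : PathConfig lam) (x : ℕ) (y : Fin n) : ω.H x y ≤ n := by
  have h := Finset.single_le_sum (f := ω.H x) (fun _ _ => Nat.zero_le _) (Finset.mem_univ y)
  rw [sum_H] at h
  exact h.trans ((Finset.card_le_univ _).trans (by simp))

lemma H_eq_zero (ω : PathConfig lam) (x : ℕ) (hx : ∀ i, lam i < x) (y : Fin n) :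
    ω.H x y = 0 := by
  have h := ω.sum_H x
  rw [Finset.filter_false_of_mem (fun i _ => not_le.mpr (hx i)), Finset.card_empty,
    Finset.sum_eq_zero_iff] at h
  exact h y (Finset.mem_univ y)

lemma V_le (ω : PathConfig lam) (x : ℕ) (y : Fin (n + 1)) : ω.V x y ≤ y * n := by
  induction y using Fin.induction with
  | zero => simp [ω.bottom]
  | succ y ih =>
    have h1 := ω.conservation x y
    have h2 := ω.H_le x y
    simp only [Fin.val_castSucc, Fin.val_succ, add_mul, one_mul] at ih ⊢
    omega

lemma V_eq_zero (ω : PathConfig lam) (x : ℕ) (hx : ∀ i, lam i < x) (y : Fin (n + 1)) :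
    ω.V x y = 0 := by
  induction y using Fin.induction with
  | zero => simp [ω.bottom]
  | succ y ih =>
    have h1 := ω.conservation x y
    have h2 := ω.H_eq_zero x hx y
    omega

/-- Only finitely many path collections have a given top boundary, so that the sum of their weights
below is an honest finite sum. -/
instance : Finite (PathConfig lam) := by
  set L := ∑ i, lam i + 1 with hL
  have hlt : ∀ x, L ≤ x → ∀ i, lam i < x := by
    intro x hx i
    have := Finset.single_le_sum (f := lam) (fun _ _ => Nat.zero_le _) (Finset.mem_univ i)
    omega
  let f : PathConfig lam →
      (Fin L → Fin (n + 1) → Fin (n * n + 1)) × (Fin L → Fin n → Fin (n + 1)) :=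
    fun ω => (fun x y => ⟨ω.V x y, Nat.lt_succ_of_le ((ω.V_le x y).trans
      (Nat.mul_le_mul_right n (Nat.le_of_lt_succ y.2)))⟩,
      fun x y => ⟨ω.H x y, Nat.lt_succ_of_le (ω.H_le x y)⟩)
  refine Finite.of_injective f ?_
  intro ω ω' h
  simp only [f, Prod.mk.injEq, funext_iff, Fin.mk.injEq] at h
  ext x y
  · by_cases hx : x < L
    · exact h.1 ⟨x, hx⟩ y
    · rw [V_eq_zero _ _ (hlt x (by omega)), V_eq_zero _ _ (hlt x (by omega))]
  · by_cases hx : x < L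
    · exact h.2 ⟨x, hx⟩ y
    · rw [H_eq_zero _ _ (hlt x (by omega)), H_eq_zero _ _ (hlt x (by omega))]

/-- Away from the poles all but finitely many factors in the weight are `1`. -/
lemma finite_mulSupport (s q : ℂ) (u : Fin n → ℂ) (hu : ∀ y, 1 - s * u y ≠ 0)
    (ω : PathConfig lam) :
    (Function.mulSupport fun x : ℕ => ∏ y : Fin n,
      vertexWeight s q (u y) (ω.V x y.castSucc) (ω.H x y) (ω.V x y.succ)
        (ω.H (x + 1) y)).Finite := by
  refine (Set.finite_lt_nat (∑ i, lam i + 1)).subset fun x hx => ?_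
  by_contra hlt
  have hlt' : ∀ i, lam i < x := by
    intro i
    have := Finset.single_le_sum (f := lam) (fun _ _ => Nat.zero_le _) (Finset.mem_univ i)
    simp only [Set.mem_ofPred_eq] at hlt
    omega
  refine hx (Finset.prod_eq_one fun y _ => ?_)
  rw [V_eq_zero _ _ hlt', V_eq_zero _ _ hlt', H_eq_zero _ _ hlt',
    H_eq_zero _ _ fun i => (hlt' i).trans (Nat.lt_succ_self x)]
  simp [vertexWeight, hu y]

end PathConfig

/-- The function `F_λ(u₁, …, u_n)`: the partition function of the path collections that enter
from the left and leave through the top at the parts of `λ`. -/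
def F (s q : ℂ) {n : ℕ} (lam : Fin n → ℕ) (u : Fin n → ℂ) : ℂ :=
  ∑ᶠ ω : PathConfig lam, ω.weight s q u

/-- The function `F_k = F_λ` for `λ = (k - 1, k - 2, …, 0)`. -/
def Fstair (s q : ℂ) (k : ℕ) (u : Fin k → ℂ) : ℂ :=
  F s q (fun i : Fin k => (i.rev : ℕ)) u

/-- The operator `D_m^k` on functions of `m` variables. The tuple `u_I` lists the `u_i`, `i ∈ I`,
in increasing order of `i`, and evaluating `g` at `I.piecewise (fun _ => s) u` is `∏_{i ∈ I} T_{u_i, s}`, that is the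
substitution `u_i = s` for all `i ∈ I`. -/
def D (s q : ℂ) (m k : ℕ) (g : (Fin m → ℂ) → ℂ) (u : Fin m → ℂ) : ℂ :=
  ∑ I ∈ Finset.powersetCard k (Finset.univ : Finset (Fin m)),
    (∏ i ∈ I, ∏ j ∈ Iᶜ, (u j - q * u i) / (u j - u i)) *
      (∏ j ∈ Iᶜ, ((u j - s) / (u j - s * q)) ^ k) *
      (Fstair s q I.card (fun a => u (I.orderEmbOfFin rfl a)) / Fstair s q k (fun _ => s)) *
      g (I.piecewise (fun _ => s) u)

end SixVertex

end

/-! The partition function is read column by column: `rowZ` composes the transfers `column`, and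
`F_eq_rowZ` identifies it with F_λ. By the Yang–Baxter equation every column preserves the relations
`Exchange` between adjacent rows. In particular, rows entered by one path each may be permuted
(`Exchange.perm`), which is the symmetry of F_λ.

The theorem compares two evaluations of the k leftmost columns. If each of them emits one path,
expanding them one at a time (`Exchange.column_expand`) writes F_λ as a sum over k-subsets I: cross
factors, times F_k(u_I), times the partition function of the rows j ∉ I, which cross the k columns
horizontally with factors ((u_j - s)/(1 - s u_j))^k (`rowZ_replicate_one_append`).

If instead u_i = s for i ∈ I, the weight (u - s)/(1 - s u) of a path going straight over an empty
vertical edge vanishes at u = s. The lowest remaining s-row must therefore turn up in each of the k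
columns, and these columns freeze. The result is F_k(S) ∏ ((u_j - s q)/(1 - s u_j))^k times the same
remainder, or zero if one of the k multiplicities is zero (`rowZ_replicate_append_fullRows`,
`rowZ_append_fullRows_eq_zero`). The coefficients of `D` convert this product into the one above, so
the terms of `D` are those of the expansion. -/

noncomputable section

namespace SixVertex

/-! ### Column transfer operators -/

/-- The transfer through one column with top multiplicity `e`, starting with `g` vertical paths
below the rows `rs` (listed from the bottom). A row is a pair of its spectral parameter and the
number of paths entering it from the left; `K` is evaluated at the rows leaving the column. -/
def column (s q : ℂ) : List (ℂ × ℕ) → ℕ → ℕ → (List (ℂ × ℕ) → ℂ) → ℂ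
  | [], g, e, K => if g = e then K [] else 0
  | (u, j) :: rs, g, e, K =>
    vertexWeight s q u g j (g + j) 0 * column s q rs (g + j) e (fun r => K ((u, 0) :: r)) +
      -- For `g = j = 0` the subtraction truncates, but the weight is then zero.
      vertexWeight s q u g j (g + j - 1) 1 *
        column s q rs (g + j - 1) e (fun r => K ((u, 1) :: r))

/-- The partition function of the rows `rs` with the given list of top multiplicities, no path
leaving through the right boundary. -/
def rowZ (s q : ℂ) : List ℕ → List (ℂ × ℕ) → ℂ
  | [], rs => (rs.map fun r => if r.2 = 0 then 1 else 0).prod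
  | e :: es, rs => column s q rs 0 e (rowZ s q es)

variable {s q : ℂ}

/-- Linearity in `K`, in the three-term form needed to carry the mixed exchange relation through a
column. -/
lemma column_linear (rs : List (ℂ × ℕ)) (g e : ℕ) (K₁ K₂ K₃ : List (ℂ × ℕ) → ℂ) (a b c : ℂ)
    (h : ∀ r, a * K₁ r = b * K₂ r + c * K₃ r) :
    a * column s q rs g e K₁ = b * column s q rs g e K₂ + c * column s q rs g e K₃ := by
  induction rs generalizing g K₁ K₂ K₃ with
  | nil =>
    simp only [column]
    split_ifs
    · exact h []
    · ring
  | cons r rs ih =>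
    obtain ⟨u, j⟩ := r
    simp only [column]
    have h1 := ih (g + j) (fun r => K₁ ((u, 0) :: r)) (fun r => K₂ ((u, 0) :: r))
      (fun r => K₃ ((u, 0) :: r)) fun r => h _
    have h2 := ih (g + j - 1) (fun r => K₁ ((u, 1) :: r)) (fun r => K₂ ((u, 1) :: r))
      (fun r => K₃ ((u, 1) :: r)) fun r => h _
    linear_combination vertexWeight s q u g j (g + j) 0 * h1 +
      vertexWeight s q u g j (g + j - 1) 1 * h2

lemma column_one (u : ℂ) (rs : List (ℂ × ℕ)) (g e : ℕ) (K : List (ℂ × ℕ) → ℂ) :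
    column s q ((u, 1) :: rs) g e K =
      (1 - q ^ (g + 1)) * (1 - s * u)⁻¹ * column s q rs (g + 1) e (fun r => K ((u, 0) :: r)) +
      (u - s * q ^ g) * (1 - s * u)⁻¹ * column s q rs g e (fun r => K ((u, 1) :: r)) := by
  simp [column, vertexWeight, div_eq_mul_inv]

/-- The quotient is left uncancelled: the exchange identities then hold without assuming su ≠ 1. -/
lemma column_zero_zero (u : ℂ) (rs : List (ℂ × ℕ)) (e : ℕ) (K : List (ℂ × ℕ) → ℂ) :
    column s q ((u, 0) :: rs) 0 e K =
      (1 - s * u) * (1 - s * u)⁻¹ * column s q rs 0 e (fun r => K ((u, 0) :: r)) := by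
  simp [column, vertexWeight, div_eq_mul_inv]

lemma column_zero_succ (u : ℂ) (rs : List (ℂ × ℕ)) (g e : ℕ) (K : List (ℂ × ℕ) → ℂ) :
    column s q ((u, 0) :: rs) (g + 1) e K =
      (1 - s * q ^ (g + 1) * u) * (1 - s * u)⁻¹ *
        column s q rs (g + 1) e (fun r => K ((u, 0) :: r)) +
      (1 - s ^ 2 * q ^ g) * u * (1 - s * u)⁻¹ *
        column s q rs g e (fun r => K ((u, 1) :: r)) := by
  simp [column, vertexWeight, div_eq_mul_inv]

/-! ### Yang–Baxter exchange relations -/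

/-- The exchange relations for two adjacent rows which follow from the Yang–Baxter equation. -/
structure Exchange (q : ℂ) (K : List (ℂ × ℕ) → ℂ) : Prop where
  zero : ∀ l l' u v, K (l ++ (u, 0) :: (v, 0) :: l') = K (l ++ (v, 0) :: (u, 0) :: l')
  one : ∀ l l' u v, K (l ++ (u, 1) :: (v, 1) :: l') = K (l ++ (v, 1) :: (u, 1) :: l')
  -- Cleared of the denominator v - u, so that equal parameters are allowed.
  mixed : ∀ l l' u v, (v - u) * K (l ++ (v, 1) :: (u, 0) :: l') =
    (v - q * u) * K (l ++ (u, 0) :: (v, 1) :: l') +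
      (-(1 - q) * u) * K (l ++ (v, 0) :: (u, 1) :: l')

lemma Exchange.cons {K : List (ℂ × ℕ) → ℂ} (hK : Exchange q K) (r : ℂ × ℕ) :
    Exchange q fun l => K (r :: l) where
  zero l l' u v := hK.zero (r :: l) l' u v
  one l l' u v := hK.one (r :: l) l' u v
  mixed l l' u v := hK.mixed (r :: l) l' u v

section YangBaxter

variable {K : List (ℂ × ℕ) → ℂ} (hK : Exchange q K) (l : List (ℂ × ℕ)) (u v : ℂ) (g e : ℕ)
include hK

lemma Exchange.column_pair_mixed :
    (v - u) * column s q l g e (fun r => K ((v, 1) :: (u, 0) :: r)) =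
    (v - q * u) * column s q l g e (fun r => K ((u, 0) :: (v, 1) :: r)) +
      (-(1 - q) * u) * column s q l g e (fun r => K ((v, 0) :: (u, 1) :: r)) :=
  column_linear _ _ _ _ _ _ _ _ _ fun r => hK.mixed [] r u v

lemma Exchange.column_pair_zero :
    column s q l g e (fun r => K ((u, 0) :: (v, 0) :: r)) =
      column s q l g e (fun r => K ((v, 0) :: (u, 0) :: r)) := by
  congr 1; funext r; exact hK.zero [] r u v

lemma Exchange.column_pair_one :
    column s q l g e (fun r => K ((u, 1) :: (v, 1) :: r)) =
      column s q l g e (fun r => K ((v, 1) :: (u, 1) :: r)) := by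
  congr 1; funext r; exact hK.one [] r u v

/-- This and the next two lemmas are the Yang–Baxter equation for two rows at the bottom of a
column. Both vertices are expanded, the outgoing rows are compared through the relations for `K`,
and after multiplication by u - v a polynomial identity remains. Small `g` is separate because an
empty vertical edge cannot emit a path. -/
lemma Exchange.column_zero_head :
    column s q ((u, 0) :: (v, 0) :: l) g e K = column s q ((v, 0) :: (u, 0) :: l) g e K := by
  rcases eq_or_ne u v with rfl | huv
  · rfl
  refine mul_left_cancel₀ (sub_ne_zero.2 huv) ?_
  have h00 := fun g => hK.column_pair_zero (s := s) l u v g e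
  have h11 := fun g => hK.column_pair_one (s := s) l u v g e
  have hvu := fun g => hK.column_pair_mixed (s := s) l u v g e
  have huv := fun g => hK.column_pair_mixed (s := s) l v u g e
  rcases g with _ | _ | g
  · simp only [column_zero_zero, h00]
    ring
  · simp only [column_zero_zero, column_zero_succ, h00, zero_add, pow_zero, pow_one] at *
    linear_combination (1 - s * u)⁻¹ * (1 - s * v)⁻¹ * (
      (1 - s ^ 2) * u * (1 - s * v) * huv 0 + (1 - s ^ 2) * v * (1 - s * u) * hvu 0)
  · simp only [column_zero_succ, h00, h11]
    linear_combination (1 - s * u)⁻¹ * (1 - s * v)⁻¹ * (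
      (1 - s ^ 2 * q ^ (g + 1)) * u * (1 - s * q ^ (g + 1) * v) * huv (g + 1) +
      (1 - s ^ 2 * q ^ (g + 1)) * v * (1 - s * q ^ (g + 1) * u) * hvu (g + 1))

lemma Exchange.column_one_head :
    column s q ((u, 1) :: (v, 1) :: l) g e K = column s q ((v, 1) :: (u, 1) :: l) g e K := by
  rcases eq_or_ne u v with rfl | huv
  · rfl
  refine mul_left_cancel₀ (sub_ne_zero.2 huv) ?_
  have h00 := fun g => hK.column_pair_zero (s := s) l u v g e
  have h11 := fun g => hK.column_pair_one (s := s) l u v g e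
  have hvu := fun g => hK.column_pair_mixed (s := s) l u v g e
  have huv := fun g => hK.column_pair_mixed (s := s) l v u g e
  simp only [column_one, h00, h11]
  linear_combination (1 - s * u)⁻¹ * (1 - s * v)⁻¹ * (1 - q ^ (g + 1)) * (
      (u - s * q ^ g) * huv (g + 1) + (v - s * q ^ g) * hvu (g + 1))

lemma Exchange.column_mixed_head :
    (v - u) * column s q ((v, 1) :: (u, 0) :: l) g e K =
    (v - q * u) * column s q ((u, 0) :: (v, 1) :: l) g e K +
      (-(1 - q) * u) * column s q ((v, 0) :: (u, 1) :: l) g e K := by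
  rcases eq_or_ne u v with rfl | huv
  · ring
  refine mul_left_cancel₀ (sub_ne_zero.2 huv) ?_
  have h00 := fun g => hK.column_pair_zero (s := s) l u v g e
  have h11 := fun g => hK.column_pair_one (s := s) l u v g e
  have hvu := fun g => hK.column_pair_mixed (s := s) l u v g e
  have huv := fun g => hK.column_pair_mixed (s := s) l v u g e
  rcases g with _ | g
  · simp only [column_one, column_zero_zero, column_zero_succ, h00]
    simp only [zero_add, pow_zero, pow_one]
    linear_combination (1 - s * u)⁻¹ * (1 - s * v)⁻¹ * (
      (u - v) * (v - s) * (1 - s * u) * hvu 0)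
  · simp only [column_one, column_zero_succ, h00, h11]
    linear_combination (1 - s * u)⁻¹ * (1 - s * v)⁻¹ * (
      (u - v) * (v - s * q ^ (g + 1)) * (1 - s * q ^ (g + 1) * u) * hvu (g + 1) -
      (v - q * u) * ((1 - s ^ 2 * q ^ g) * u * (1 - q ^ (g + 1))) * huv (g + 1) +
      (-(1 - q) * u) * ((1 - s ^ 2 * q ^ g) * v * (1 - q ^ (g + 1))) * hvu (g + 1))

end YangBaxter

lemma Exchange.map_column {K : List (ℂ × ℕ) → ℂ} (hK : Exchange q K) (g e : ℕ) :
    Exchange q fun r => column s q r g e K where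
  zero l l' u v := by
    induction l generalizing g K with
    | nil => exact hK.column_zero_head l' u v g e
    | cons r l ih =>
      obtain ⟨w, j⟩ := r
      simp only [List.cons_append, column, ih (hK.cons _)]
  one l l' u v := by
    induction l generalizing g K with
    | nil => exact hK.column_one_head l' u v g e
    | cons r l ih =>
      obtain ⟨w, j⟩ := r
      simp only [List.cons_append, column, ih (hK.cons _)]
  mixed l l' u v := by
    induction l generalizing g K with
    | nil => exact hK.column_mixed_head l' u v g e
    | cons r l ih =>
      obtain ⟨w, j⟩ := r
      simp only [List.cons_append, column]
      linear_combination vertexWeight s q w g j (g + j) 0 * ih (hK.cons (w, 0)) (g + j) +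
        vertexWeight s q w g j (g + j - 1) 1 * ih (hK.cons (w, 1)) (g + j - 1)

lemma exchange_rowZ (es : List ℕ) : Exchange q (rowZ s q es) := by
  induction es with
  | nil =>
    constructor
    · intro l l' u v
      simp [rowZ]
    · intro l l' u v
      simp [rowZ]
    · intro l l' u v
      simp [rowZ]
  | cons e es ih => exact ih.map_column 0 e

lemma Exchange.perm {ι : Type*} (u : ι → ℂ) {K : List (ℂ × ℕ) → ℂ} (hK : Exchange q K)
    {l l' : List ι} (h : l.Perm l') :
    K (l.map fun i => (u i, 1)) = K (l'.map fun i => (u i, 1)) := by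
  induction h generalizing K with
  | nil => rfl
  | cons i _ ih => exact ih (hK.cons (u i, 1))
  | swap i j l => exact hK.one [] _ (u j) (u i)
  | trans _ _ ih₁ ih₂ => exact (ih₁ hK).trans (ih₂ hK)

/-- When every row brings in a path, the number of vertical paths never decreases on the way up. -/
lemma column_full_of_lt {ι : Type*} (u : ι → ℂ) (l : List ι) {g e : ℕ} (h : e < g)
    (K : List (ℂ × ℕ) → ℂ) : column s q (l.map fun i => (u i, 1)) g e K = 0 := by
  induction l generalizing g K with
  | nil => simp [column, h.ne']
  | cons i l ih => rw [List.map_cons, column_one, ih (by omega), ih h]; ring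

/-- No path can turn up without exceeding the top multiplicity, so all go straight. -/
lemma column_full_self {ι : Type*} (u : ι → ℂ) (l : List ι) (g : ℕ) (K : List (ℂ × ℕ) → ℂ) :
    column s q (l.map fun i => (u i, 1)) g g K =
      (l.map fun i => (u i - s * q ^ g) * (1 - s * u i)⁻¹).prod *
        K (l.map fun i => (u i, 1)) := by
  induction l generalizing K with
  | nil => simp [column]
  | cons i l ih =>
    rw [List.map_cons, column_one, column_full_of_lt u l (Nat.lt_succ_self g), ih]
    simp only [List.map_cons, List.prod_cons]
    ring

/-- A row without incoming paths at the bottom contributes trivially. -/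
lemma rowZ_zero_cons {w : ℂ} (hw : s * w ≠ 1) (es : List ℕ) (rs : List (ℂ × ℕ)) :
    rowZ s q es ((w, 0) :: rs) = rowZ s q es rs := by
  induction es generalizing rs with
  | nil => simp [rowZ]
  | cons e es ih =>
    simp only [rowZ]
    rw [column_zero_zero, mul_inv_cancel₀ (sub_ne_zero.2 hw.symm), one_mul]
    simp only [ih]

/-! ### Expansion of a column emitting one path -/

section Expansion

variable {ι : Type*} (u : ι → ℂ)

/-- The rows with spectral parameters `u i`, `i ∈ S`, each entered by one path from the left. -/
def fullRows (S : Finset ι) : List (ℂ × ℕ) := S.toList.map fun i => (u i, 1)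

variable {u}

lemma column_fullRows (S : Finset ι) (g : ℕ) (K : List (ℂ × ℕ) → ℂ) :
    column s q (fullRows u S) g g K =
      (∏ i ∈ S, (u i - s * q ^ g) * (1 - s * u i)⁻¹) * K (fullRows u S) := by
  rw [fullRows, column_full_self, Finset.prod_map_toList]

variable [DecidableEq ι]

lemma Exchange.fullRows_insert {K : List (ℂ × ℕ) → ℂ} (hK : Exchange q K) {i : ι}
    {S : Finset ι} (hi : i ∉ S) : K (fullRows u (insert i S)) = K ((u i, 1) :: fullRows u S) :=
  hK.perm u (Finset.toList_insert hi)

/-- For f(x) = ∏ (u_j - q x)/(u_j - x), this compares the partial fraction expansions of f(u_a) and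
f(s). Multiplication by ∏ (u_j - s)/(1 - s u_j) removes the poles at u_j = s. -/
lemma prod_partialFraction (hu : Function.Injective u) (S : Finset ι) {a : ι} (ha : a ∉ S) :
    ∏ j ∈ S, (u j - s * q) * (1 - s * u j)⁻¹ =
      ∏ j ∈ S, (u j - s) * (1 - s * u j)⁻¹ * ((u j - q * u a) / (u j - u a)) -
      (u a - s) * ∑ i ∈ S, (1 - s * u i)⁻¹ *
        (∏ j ∈ S.erase i, (u j - s) * (1 - s * u j)⁻¹ * ((u j - q * u i) / (u j - u i))) *
        ((1 - q) * u i / (u i - u a)) := by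
  induction S using Finset.induction_on generalizing a with
  | empty => simp
  | insert b S hb ih =>
    rw [Finset.mem_insert, not_or] at ha
    obtain ⟨hab, ha⟩ := ha
    have hba : u b - u a ≠ 0 := sub_ne_zero.2 (hu.ne (Ne.symm hab))
    -- Splitting the product of the poles u_i = u_b and u_i = u_a produces one sum for each, hence
    -- the induction hypothesis at both `a` and `b`.
    have h1 := ih ha
    have h2 := ih hb
    rw [Finset.prod_insert hb, Finset.prod_insert hb, Finset.sum_insert hb,
      Finset.erase_insert hb]
    have h3 : ∑ i ∈ S, (1 - s * u i)⁻¹ * (∏ j ∈ (insert b S).erase i,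
          (u j - s) * (1 - s * u j)⁻¹ * ((u j - q * u i) / (u j - u i))) *
          ((1 - q) * u i / (u i - u a)) =
        (u b - s) * (1 - s * u b)⁻¹ * (((u b - q * u a) / (u b - u a)) *
          (∑ i ∈ S, (1 - s * u i)⁻¹ * (∏ j ∈ S.erase i,
            (u j - s) * (1 - s * u j)⁻¹ * ((u j - q * u i) / (u j - u i))) *
            ((1 - q) * u i / (u i - u a))) - ((1 - q) * u b / (u b - u a)) *
          (∑ i ∈ S, (1 - s * u i)⁻¹ * (∏ j ∈ S.erase i,
            (u j - s) * (1 - s * u j)⁻¹ * ((u j - q * u i) / (u j - u i))) *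
            ((1 - q) * u i / (u i - u b)))) := by
      rw [Finset.mul_sum, Finset.mul_sum, ← Finset.sum_sub_distrib, Finset.mul_sum]
      refine Finset.sum_congr rfl fun i hi => ?_
      have hbi : b ≠ i := fun h => hb (h ▸ hi)
      have hai : a ≠ i := fun h => ha (h ▸ hi)
      rw [Finset.erase_insert_of_ne hbi, Finset.prod_insert (by simp [hb])]
      have hib : u i - u b ≠ 0 := sub_ne_zero.2 (hu.ne hbi.symm)
      have hbi : u b - u i ≠ 0 := sub_ne_zero.2 (hu.ne hbi)
      have hia : u i - u a ≠ 0 := sub_ne_zero.2 (hu.ne hai.symm)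
      have h4 : (u b - q * u i) / (u b - u i) * ((1 - q) * u i / (u i - u a)) =
          (u b - q * u a) / (u b - u a) * ((1 - q) * u i / (u i - u a)) -
          ((1 - q) * u b / (u b - u a)) * ((1 - q) * u i / (u i - u b)) := by
        rw [← neg_sub (u i) (u b)] at *
        field_simp
        ring
      linear_combination (u b - s) * (1 - s * u b)⁻¹ * (1 - s * u i)⁻¹ * (∏ j ∈ S.erase i,
            (u j - s) * (1 - s * u j)⁻¹ * ((u j - q * u i) / (u j - u i))) * h4
    rw [h3]
    have h5 : u b - s * q = (u b - s) * ((u b - q * u a) / (u b - u a)) -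
        (u a - s) * ((1 - q) * u b / (u b - u a)) := by
      field_simp
      ring
    rw [h5]
    linear_combination (u b - s) * (1 - s * u b)⁻¹ * ((u b - q * u a) / (u b - u a)) * h1 -
      (u a - s) * (1 - s * u b)⁻¹ * ((1 - q) * u b / (u b - u a)) * h2

/-- The expansion of a column which one path leaves through the top. -/
lemma Exchange.column_expand (hu : Function.Injective u) {K : List (ℂ × ℕ) → ℂ}
    (hK : Exchange q K) (S : Finset ι) :
    column s q (fullRows u S) 0 1 K =
      ∑ i ∈ S, (1 - q) * (1 - s * u i)⁻¹ *
        (∏ j ∈ S.erase i, (u j - s) * (1 - s * u j)⁻¹ * ((u j - q * u i) / (u j - u i))) *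
        K ((u i, 0) :: fullRows u (S.erase i)) := by
  induction S using Finset.induction_on generalizing K with
  | empty => simp [fullRows, column]
  | insert a S ha ih =>
    -- By symmetry row `a` is put at the bottom. Its path either turns up, forcing all others
    -- straight, or goes straight, leaving a smaller column.
    rw [(hK.map_column (s := s) 0 1).fullRows_insert ha, column_one, ih (hK.cons _), zero_add,
      column_fullRows, Finset.sum_insert ha, Finset.erase_insert ha]
    -- The mixed relation moves the empty row to the bottom; the terms in which row `a` becomes the
    -- empty one are summed by `prod_partialFraction`.
    have h1 : ∀ i ∈ S, K ((u a, 1) :: (u i, 0) :: fullRows u (S.erase i)) =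
        (u a - q * u i) / (u a - u i) * K ((u i, 0) :: fullRows u ((insert a S).erase i)) +
        (1 - q) * u i / (u i - u a) * K ((u a, 0) :: fullRows u S) := by
      intro i hi
      have hai : a ≠ i := fun h => ha (h ▸ hi)
      have h2 := hK.mixed [] (fullRows u (S.erase i)) (u i) (u a)
      simp only [List.nil_append] at h2
      have h3 := (hK.cons (u i, 0)).fullRows_insert (u := u) (i := a) (S := S.erase i)
        (by simp [ha])
      have h4 := (hK.cons (u a, 0)).fullRows_insert (u := u) (i := i) (S := S.erase i)
        (by simp)
      rw [Finset.insert_erase hi] at h4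
      rw [Finset.erase_insert_of_ne hai, h3, h4]
      have hia : u i - u a ≠ 0 := sub_ne_zero.2 (hu.ne hai.symm)
      have hai : u a - u i ≠ 0 := sub_ne_zero.2 (hu.ne hai)
      refine mul_left_cancel₀ hai (h2.trans ?_)
      rw [← neg_sub (u i) (u a)] at *
      field_simp
      ring
    have h2 : ∑ i ∈ S, (1 - q) * (1 - s * u i)⁻¹ *
          (∏ j ∈ S.erase i, (u j - s) * (1 - s * u j)⁻¹ * ((u j - q * u i) / (u j - u i))) *
          K ((u a, 1) :: (u i, 0) :: fullRows u (S.erase i)) =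
        ∑ i ∈ S, (1 - q) * (1 - s * u i)⁻¹ *
          (∏ j ∈ S.erase i, (u j - s) * (1 - s * u j)⁻¹ * ((u j - q * u i) / (u j - u i))) *
          ((u a - q * u i) / (u a - u i) * K ((u i, 0) :: fullRows u ((insert a S).erase i))) +
        (1 - q) * K ((u a, 0) :: fullRows u S) * ∑ i ∈ S, (1 - s * u i)⁻¹ *
          (∏ j ∈ S.erase i, (u j - s) * (1 - s * u j)⁻¹ * ((u j - q * u i) / (u j - u i))) *
          ((1 - q) * u i / (u i - u a)) := by
      rw [Finset.mul_sum, ← Finset.sum_add_distrib]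
      refine Finset.sum_congr rfl fun i hi => ?_
      rw [h1 i hi]
      ring
    have h3 : ∑ i ∈ S, (1 - q) * (1 - s * u i)⁻¹ *
          (∏ j ∈ (insert a S).erase i,
            (u j - s) * (1 - s * u j)⁻¹ * ((u j - q * u i) / (u j - u i))) *
          K ((u i, 0) :: fullRows u ((insert a S).erase i)) =
        (u a - s) * (1 - s * u a)⁻¹ * ∑ i ∈ S, (1 - q) * (1 - s * u i)⁻¹ *
          (∏ j ∈ S.erase i, (u j - s) * (1 - s * u j)⁻¹ * ((u j - q * u i) / (u j - u i))) *
          ((u a - q * u i) / (u a - u i) *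
            K ((u i, 0) :: fullRows u ((insert a S).erase i))) := by
      rw [Finset.mul_sum]
      refine Finset.sum_congr rfl fun i hi => ?_
      have hai : a ≠ i := fun h => ha (h ▸ hi)
      have h4 : ∏ j ∈ (insert a S).erase i,
            (u j - s) * (1 - s * u j)⁻¹ * ((u j - q * u i) / (u j - u i)) =
          (u a - s) * (1 - s * u a)⁻¹ * ((u a - q * u i) / (u a - u i)) *
            ∏ j ∈ S.erase i,
              (u j - s) * (1 - s * u j)⁻¹ * ((u j - q * u i) / (u j - u i)) := by
        rw [Finset.erase_insert_of_ne hai, Finset.prod_insert (by simp [ha])]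
      rw [h4]
      ring
    rw [h3, h2]
    simp only [pow_one, pow_zero, mul_one]
    linear_combination (1 - q) * (1 - s * u a)⁻¹ * K ((u a, 0) :: fullRows u S) *
      prod_partialFraction (s := s) (q := q) hu S ha

end Expansion

/-! ### Identification of F_λ with the column transfers -/

lemma vertexWeight_ne_zero {u : ℂ} {i₁ j₁ i₂ j₂ : ℕ} (h : vertexWeight s q u i₁ j₁ i₂ j₂ ≠ 0) :
    i₁ + j₁ = i₂ + j₂ ∧ j₂ ≤ 1 := by
  unfold vertexWeight at h
  split at h <;> simp_all

/-- The weight of a column with `g` paths entering from below and `e` paths leaving through the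
top, where `j` and `j'` count the paths entering the rows from the left and leaving them to the
right. -/
def columnWeight (s q : ℂ) : {n : ℕ} → (Fin n → ℂ) → ℕ → ℕ → (Fin n → ℕ) → (Fin n → ℕ) → ℂ
  | 0, _, g, e, _, _ => if g = e then 1 else 0
  | _ + 1, u, g, e, j, j' =>
    vertexWeight s q (u 0) g (j 0) (g + j 0 - j' 0) (j' 0) *
      columnWeight s q (Fin.tail u) (g + j 0 - j' 0) e (Fin.tail j) (Fin.tail j')

lemma columnWeight_eq_prod {n : ℕ} (u : Fin n → ℂ) (V : Fin (n + 1) → ℕ) (j j' : Fin n → ℕ)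
    (hV : ∀ y : Fin n, V y.castSucc + j y = V y.succ + j' y) :
    columnWeight s q u (V 0) (V (Fin.last n)) j j' =
      ∏ y : Fin n, vertexWeight s q (u y) (V y.castSucc) (j y) (V y.succ) (j' y) := by
  induction n with
  | zero => simp [columnWeight]
  | succ n ih =>
    have h0 : V 0 + j 0 - j' 0 = V 1 := by
      have := hV 0
      rw [Fin.castSucc_zero, Fin.succ_zero_eq_one] at this
      omega
    have h1 := ih (Fin.tail u) (Fin.tail V) (Fin.tail j) (Fin.tail j') fun y => by
      simpa [Fin.tail] using hV y.succ
    rw [columnWeight, Fin.prod_univ_succ, h0]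
    simp only [Fin.tail, Fin.succ_last, Fin.succ_zero_eq_one] at h1
    simp only [Fin.castSucc_zero, Fin.succ_zero_eq_one]
    exact congrArg _ h1

/-- A nonzero weight forces conservation at each vertex, so the truncated subtraction in
`columnWeight` is a true one. -/
lemma exists_of_columnWeight_ne_zero {n : ℕ} {u : Fin n → ℂ} {g e : ℕ} {j j' : Fin n → ℕ}
    (h : columnWeight s q u g e j j' ≠ 0) :
    ∃ V : Fin (n + 1) → ℕ, V 0 = g ∧ V (Fin.last n) = e ∧
      ∀ y : Fin n, V y.castSucc + j y = V y.succ + j' y := by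
  induction n generalizing g with
  | zero =>
    refine ⟨fun _ => g, rfl, ?_, fun y => y.elim0⟩
    by_contra hg
    exact h (by rw [columnWeight, if_neg hg])
  | succ n ih =>
    rw [columnWeight] at h
    obtain ⟨V, hV0, hVl, hV⟩ := ih (right_ne_zero_of_mul h)
    have h1 := (vertexWeight_ne_zero (left_ne_zero_of_mul h)).1
    refine ⟨Fin.cons g V, rfl, by rw [← Fin.succ_last, Fin.cons_succ, hVl], fun y => ?_⟩
    refine Fin.cases ?_ (fun y => ?_) y
    · rw [Fin.castSucc_zero, Fin.cons_zero, Fin.cons_succ, hV0]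
      exact h1
    · rw [Fin.castSucc_succ, Fin.cons_succ, Fin.cons_succ]
      exact hV y

lemma column_ofFn {n : ℕ} (u : Fin n → ℂ) (j : Fin n → ℕ) (g e : ℕ)
    (K : List (ℂ × ℕ) → ℂ) :
    column s q (List.ofFn fun y => (u y, j y)) g e K =
      ∑ h : Fin n → Fin 2, columnWeight s q u g e j (fun y => h y) *
        K (List.ofFn fun y => (u y, (h y : ℕ))) := by
  induction n generalizing g K with
  | zero => simp [column, columnWeight]
  | succ n ih =>
    rw [List.ofFn_succ, column, ← Fintype.sum_equiv (Fin.consEquiv fun _ => Fin 2) _ _ fun _ => rfl,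
      Fintype.sum_prod_type, Fin.sum_univ_two]
    have h1 := fun g K => ih (Fin.tail u) (Fin.tail j) g K
    simp only [Fin.tail] at h1
    rw [h1, h1, Finset.mul_sum, Finset.mul_sum]
    congr 1 <;> refine Finset.sum_congr rfl fun h _ => ?_ <;>
      simp [columnWeight, Fin.consEquiv, List.ofFn_succ, mul_assoc] <;>
      exact Or.inl (Or.inl rfl)

/-- `h x` records the edges leaving column `x`. Prepending `j` makes index `x` the edges entering
column `x`, and the last index the right boundary, which must be empty. -/
lemma rowZ_ofFn {n L : ℕ} (u : Fin n → ℂ) (j : Fin n → ℕ) (e : Fin L → ℕ) :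
    rowZ s q (List.ofFn e) (List.ofFn fun y => (u y, j y)) =
      ∑ h : Fin L → Fin n → Fin 2,
        (∏ x : Fin L, columnWeight s q u 0 (e x)
          ((Fin.cons j fun x y => (h x y : ℕ) : Fin (L + 1) → Fin n → ℕ) x.castSucc)
          (fun y => h x y)) *
        if (Fin.cons j fun x y => (h x y : ℕ) : Fin (L + 1) → Fin n → ℕ) (Fin.last L) = 0
          then 1 else 0 := by
  induction L generalizing j with
  | zero =>
    simp only [List.ofFn_zero, rowZ, List.map_ofFn, List.prod_ofFn]
    by_cases hj : j = 0
    · simp [hj]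
    · obtain ⟨y, hy⟩ := Function.ne_iff.1 hj
      simp only [Finset.univ_unique, Finset.univ_eq_empty, Finset.prod_empty, one_mul,
        Finset.sum_singleton]
      rw [if_neg (by simpa using hj)]
      exact Finset.prod_eq_zero (Finset.mem_univ y) (if_neg hy)
  | succ L ih =>
    rw [List.ofFn_succ, rowZ, column_ofFn,
      ← Fintype.sum_equiv (Fin.consEquiv fun _ => Fin n → Fin 2) _ _ fun _ => rfl,
      Fintype.sum_prod_type]
    refine Finset.sum_congr rfl fun h _ => ?_
    rw [ih, Finset.mul_sum]
    refine Finset.sum_congr rfl fun h' _ => ?_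
    rw [← mul_assoc, Fin.prod_univ_succ]
    have h1 : (fun x y => ((Fin.consEquiv (fun _ => Fin n → Fin 2) (h, h') x y : Fin 2) : ℕ)) =
        (Fin.cons (fun y => (h y : ℕ)) fun x y => (h' x y : ℕ) : Fin (L + 1) → Fin n → ℕ) := by
      funext x
      refine Fin.cases ?_ (fun x => ?_) x <;> simp [Fin.consEquiv]
    simp only [h1, ← Fin.succ_last, Fin.cons_succ, Fin.castSucc_succ]
    simp [Fin.consEquiv]

namespace PathConfig

variable {n : ℕ} {lam : Fin n → ℕ}

lemma weight_eq_prod {u : Fin n → ℂ} (hu : ∀ y, s * u y ≠ 1) {L : ℕ} (hL : ∀ i, lam i < L)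
    (ω : PathConfig lam) :
    ω.weight s q u = ∏ x : Fin L,
      columnWeight s q u 0 (mult lam x) (ω.H x) (ω.H (x + 1)) := by
  have h1 : ∀ x : ℕ, columnWeight s q u 0 (mult lam x) (ω.H x) (ω.H (x + 1)) = ∏ y : Fin n,
      vertexWeight s q (u y) (ω.V x y.castSucc) (ω.H x y) (ω.V x y.succ) (ω.H (x + 1) y) := by
    intro x
    rw [← columnWeight_eq_prod u (ω.V x) (ω.H x) (ω.H (x + 1)) (ω.conservation x), ω.bottom,
      ω.top]
  simp only [h1]
  rw [weight, finprod_eq_prod_of_mulSupport_subset (s := Finset.range L), Finset.prod_range]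
  intro x hx
  by_contra hlt
  have hlt' : ∀ i, lam i < x := by
    intro i
    have := hL i
    simp only [Finset.coe_range, Set.mem_Iio, not_lt] at hlt
    omega
  refine hx (Finset.prod_eq_one fun y _ => ?_)
  rw [V_eq_zero _ _ hlt', V_eq_zero _ _ hlt', H_eq_zero _ _ hlt',
    H_eq_zero _ _ fun i => (hlt' i).trans (Nat.lt_succ_self x)]
  simp [vertexWeight, sub_ne_zero.2 (hu y).symm]

lemma H_le_one_of_weight_ne_zero {u : Fin n → ℂ} (hu : ∀ y, s * u y ≠ 1) {ω : PathConfig lam}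
    (h : ω.weight s q u ≠ 0) (x : ℕ) (y : Fin n) : ω.H x y ≤ 1 := by
  rcases x with _ | x
  · rw [ω.left]
  · by_contra h1
    refine h (finprod_eq_zero _ x ?_ (ω.finite_mulSupport s q u fun y => sub_ne_zero.2 (hu y).symm))
    refine Finset.prod_eq_zero (Finset.mem_univ y) ?_
    by_contra h2
    exact h1 (vertexWeight_ne_zero h2).2

lemma eq_of_H_eq {ω ω' : PathConfig lam} (h : ∀ x y, ω.H x y = ω'.H x y) : ω = ω' := by
  ext x y
  · induction y using Fin.induction with
    | zero => rw [ω.bottom, ω'.bottom]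
    | succ y ih =>
      have h1 := ω.conservation x y
      have h2 := ω'.conservation x y
      rw [h, h, ih] at h1
      omega
  · exact h x y

end PathConfig

lemma F_eq_rowZ {n : ℕ} (lam : Fin n → ℕ) {u : Fin n → ℂ} (hu : ∀ y, s * u y ≠ 1) {L : ℕ}
    (hL : ∀ i, lam i < L) :
    F s q lam u = rowZ s q (List.ofFn fun x : Fin L => mult lam x)
      (List.ofFn fun y => (u y, 1)) := by
  classical
  have : Fintype (PathConfig lam) := Fintype.ofFinite _
  rw [F, finsum_eq_sum_of_fintype, rowZ_ofFn u fun _ => 1]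
  have key : ∀ ω : PathConfig lam, (∀ x y, ω.H x y ≤ 1) → ∀ x : Fin (L + 1),
      (Fin.cons (fun _ => 1) fun x y => ((Fin.ofNat 2 (ω.H (x + 1) y) : Fin 2) : ℕ) :
        Fin (L + 1) → Fin n → ℕ) x = ω.H x := by
    intro ω hω x
    funext y
    refine Fin.cases ?_ (fun x => ?_) x
    · simp [ω.left]
    · have := hω (x + 1) y
      simp only [Fin.cons_succ, Fin.val_ofNat, Fin.val_succ]
      omega
  have hw : ∀ ω : PathConfig lam, (∀ x y, ω.H x y ≤ 1) → ω.weight s q u =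
      (∏ x : Fin L, columnWeight s q u 0 (mult lam x)
          ((Fin.cons (fun _ => 1) fun x y => ((Fin.ofNat 2 (ω.H (x + 1) y) : Fin 2) : ℕ) :
            Fin (L + 1) → Fin n → ℕ) x.castSucc)
          (fun y => (Fin.ofNat 2 (ω.H (x + 1) y) : Fin 2))) *
        if (Fin.cons (fun _ => 1) fun x y => ((Fin.ofNat 2 (ω.H (x + 1) y) : Fin 2) : ℕ) :
            Fin (L + 1) → Fin n → ℕ) (Fin.last L) = 0
          then 1 else 0 := by
    intro ω hω
    have hl : ω.H (Fin.last L : Fin (L + 1)) = 0 :=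
      funext fun y => ω.H_eq_zero _ (by simpa using hL) y
    rw [key ω hω, if_pos hl, mul_one, ω.weight_eq_prod hu hL]
    refine Finset.prod_congr rfl fun x _ => ?_
    rw [key ω hω]
    have := key ω hω x.succ
    rw [Fin.cons_succ] at this
    rw [this]
    simp
  -- Collections with two paths on a horizontal edge have weight zero; on the others reduction
  -- modulo 2 loses nothing, and conservation recovers the vertical edges.
  refine Finset.sum_bij_ne_zero
    (fun ω _ _ => fun (x : Fin L) y => (Fin.ofNat 2 (ω.H (x + 1) y) : Fin 2))
    (fun _ _ _ => Finset.mem_univ _) ?_ ?_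
    (fun ω _ h => hw ω (PathConfig.H_le_one_of_weight_ne_zero hu h))
  · intro ω _ h ω' _ h' heq
    replace h := PathConfig.H_le_one_of_weight_ne_zero hu h
    replace h' := PathConfig.H_le_one_of_weight_ne_zero hu h'
    refine PathConfig.eq_of_H_eq fun x y => ?_
    rcases x with _ | x
    · rw [ω.left, ω'.left]
    · by_cases hx : x < L
      · have h1 := congrArg Fin.val (congrFun (congrFun heq ⟨x, hx⟩) y)
        simp only [Fin.val_ofNat] at h1
        have := h (x + 1) y
        have := h' (x + 1) y
        omega
      · have : ∀ i, lam i < x + 1 := fun i => by have := hL i; omega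
        rw [ω.H_eq_zero _ this, ω'.H_eq_zero _ this]
  · intro b _ hb
    set c : Fin (L + 1) → Fin n → ℕ := Fin.cons (fun _ => 1) fun x y => (b x y : ℕ) with hc
    have hcs : ∀ x : Fin L, c x.succ = fun y => (b x y : ℕ) := fun x => by rw [hc, Fin.cons_succ]
    have hlast : c (Fin.last L) = 0 := by
      by_contra h
      exact right_ne_zero_of_mul hb (if_neg h)
    have hV : ∀ x : Fin L, ∃ V : Fin (n + 1) → ℕ, V 0 = 0 ∧ V (Fin.last n) = mult lam x ∧
        ∀ y : Fin n, V y.castSucc + c x.castSucc y = V y.succ + c x.succ y := by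
      intro x
      have := Finset.prod_ne_zero_iff.1 (left_ne_zero_of_mul hb) x (Finset.mem_univ x)
      rw [← hcs] at this
      exact exists_of_columnWeight_ne_zero this
    choose V hV0 hVl hVc using hV
    let ω : PathConfig lam :=
      { V := fun x y => if h : x < L then V ⟨x, h⟩ y else 0
        H := fun x y => if h : x < L + 1 then c ⟨x, h⟩ y else 0
        left := fun y => by simp [hc]
        bottom := fun x => by
          by_cases h : x < L
          · simp [h, hV0]
          · simp [h]
        top := fun x => by
          by_cases h : x < L
          · simp [h, hVl]
          · have : mult lam x = 0 := by
              rw [mult, Finset.card_eq_zero, Finset.filter_eq_empty_iff]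
              intro i _
              have := hL i
              omega
            simp [h, this]
        conservation := fun x y => by
          by_cases h : x < L
          · have := hVc ⟨x, h⟩ y
            simp only [Fin.castSucc_mk, Fin.succ_mk] at this
            simpa [h, h.trans (Nat.lt_succ_self L)] using this
          · by_cases h' : x < L + 1
            · obtain rfl : x = L := by omega
              have := congrFun hlast y
              simp only [Fin.last] at this
              simp [this]
            · have h2 : ¬ x + 1 < L + 1 := by omega
              simp [h, h'] }
    have hωH : ∀ x y, ω.H x y ≤ 1 := by
      intro x y
      by_cases h : x < L + 1
      · simp only [ω, h, dif_pos]
        generalize (⟨x, h⟩ : Fin (L + 1)) = z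
        refine Fin.cases ?_ (fun z => ?_) z
        · simp [hc]
        · rw [hcs]
          exact Nat.le_of_lt_succ (b z y).2
      · simp [ω, h]
    have hωb : (fun (x : Fin L) y => (Fin.ofNat 2 (ω.H (x + 1) y) : Fin 2)) = b := by
      funext x y
      have h1 : ω.H (x + 1) y = b x y := by
        have : (⟨(x : ℕ) + 1, by omega⟩ : Fin (L + 1)) = x.succ := rfl
        simp only [ω]
        rw [dif_pos (by omega), this, hcs]
      rw [h1]
      ext
      simp
    refine ⟨ω, Finset.mem_univ _, ?_, hωb⟩
    rw [hw ω hωH]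
    simp only [funext_iff] at hωb
    simp only [hωb]
    exact hb

/-! ### Splitting off the staircase -/

section

variable {ι : Type*} {u : ι → ℂ}

lemma rowZ_zero_fullRows (S : Finset ι) (es : List ℕ) :
    rowZ s q (0 :: es) (fullRows u S) =
      (∏ i ∈ S, (u i - s) * (1 - s * u i)⁻¹) * rowZ s q es (fullRows u S) := by
  rw [rowZ, column_fullRows]
  simp

lemma rowZ_replicate_zero_fullRows (S : Finset ι) (k : ℕ) (es : List ℕ) :
    rowZ s q (List.replicate k 0 ++ es) (fullRows u S) =
      (∏ i ∈ S, ((u i - s) * (1 - s * u i)⁻¹) ^ k) * rowZ s q es (fullRows u S) := by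
  induction k with
  | zero => simp
  | succ k ih =>
    rw [List.replicate_succ, List.cons_append, rowZ_zero_fullRows, ih, ← mul_assoc,
      ← Finset.prod_mul_distrib]
    simp only [pow_succ']

variable [DecidableEq ι]

lemma rowZ_one_fullRows (hu : Function.Injective u) (hsu : ∀ i, s * u i ≠ 1) (S : Finset ι)
    (es : List ℕ) :
    rowZ s q (1 :: es) (fullRows u S) =
      ∑ i ∈ S, (1 - q) * (1 - s * u i)⁻¹ *
        (∏ j ∈ S.erase i, (u j - s) * (1 - s * u j)⁻¹ * ((u j - q * u i) / (u j - u i))) *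
        rowZ s q es (fullRows u (S.erase i)) := by
  rw [rowZ, (exchange_rowZ es).column_expand hu]
  simp only [rowZ_zero_cons (hsu _)]

/-- The staircase of smallest parts can be split off by symmetrizing over its variables. -/
lemma rowZ_replicate_one_append (hu : Function.Injective u) (hsu : ∀ i, s * u i ≠ 1)
    (S : Finset ι) (k : ℕ) (es : List ℕ) :
    rowZ s q (List.replicate k 1 ++ es) (fullRows u S) =
      ∑ I ∈ S.powersetCard k, (∏ i ∈ I, ∏ j ∈ S \ I, (u j - q * u i) / (u j - u i)) *
        rowZ s q (List.replicate k 0 ++ es) (fullRows u (S \ I)) *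
        rowZ s q (List.replicate k 1) (fullRows u I) := by
  induction k generalizing S es with
  | zero => simp [rowZ, fullRows]
  | succ k ih =>
    have hL : rowZ s q (List.replicate (k + 1) 1 ++ es) (fullRows u S) =
        ∑ i ∈ S, ∑ J ∈ (S.erase i).powersetCard k, (1 - q) * (1 - s * u i)⁻¹ *
        (∏ j ∈ S.erase i, (u j - s) * (1 - s * u j)⁻¹ * ((u j - q * u i) / (u j - u i))) *
        ((∏ a ∈ J, ∏ j ∈ S.erase i \ J, (u j - q * u a) / (u j - u a)) *
        rowZ s q (List.replicate k 0 ++ es) (fullRows u (S.erase i \ J)) *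
        rowZ s q (List.replicate k 1) (fullRows u J)) := by
      rw [List.replicate_succ, List.cons_append, rowZ_one_fullRows hu hsu]
      simp only [ih, Finset.mul_sum]
    have hR : ∀ I ∈ S.powersetCard (k + 1),
        (∏ i ∈ I, ∏ j ∈ S \ I, (u j - q * u i) / (u j - u i)) *
        rowZ s q (List.replicate (k + 1) 0 ++ es) (fullRows u (S \ I)) *
        rowZ s q (List.replicate (k + 1) 1) (fullRows u I) =
        ∑ i ∈ I, (∏ i ∈ I, ∏ j ∈ S \ I, (u j - q * u i) / (u j - u i)) *
        ((∏ i ∈ S \ I, (u i - s) * (1 - s * u i)⁻¹) *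
          rowZ s q (List.replicate k 0 ++ es) (fullRows u (S \ I))) *
        ((1 - q) * (1 - s * u i)⁻¹ *
        (∏ j ∈ I.erase i, (u j - s) * (1 - s * u j)⁻¹ * ((u j - q * u i) / (u j - u i))) *
        rowZ s q (List.replicate k 1) (fullRows u (I.erase i))) := by
      intro I _
      rw [List.replicate_succ, List.replicate_succ, List.cons_append, rowZ_one_fullRows hu hsu,
        rowZ_zero_fullRows, Finset.mul_sum]
    rw [hL, Finset.sum_congr rfl hR, Finset.sum_sigma', Finset.sum_sigma']
    -- Here `i` is the index chosen in the first column and `J` the set chosen in the next `k`; on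
    -- the other side `I = insert i J` comes first and `i` is then chosen inside it.
    refine Finset.sum_bij' (fun x _ => ⟨insert x.1 x.2, x.1⟩) (fun x _ => ⟨x.2, x.1.erase x.2⟩)
      ?_ ?_ ?_ ?_ ?_
    · rintro ⟨i, J⟩ h
      simp only [Finset.mem_sigma, Finset.mem_powersetCard, Finset.subset_erase] at h ⊢
      obtain ⟨hi, ⟨hJ, hiJ⟩, hc⟩ := h
      exact ⟨⟨Finset.insert_subset hi hJ, by rw [Finset.card_insert_of_notMem hiJ, hc]⟩,
        Finset.mem_insert_self _ _⟩
    · rintro ⟨I, i⟩ h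
      simp only [Finset.mem_sigma, Finset.mem_powersetCard] at h ⊢
      obtain ⟨⟨hI, hc⟩, hi⟩ := h
      exact ⟨hI hi, Finset.erase_subset_erase _ hI, by rw [Finset.card_erase_of_mem hi, hc]; rfl⟩
    · rintro ⟨i, J⟩ h
      simp only [Finset.mem_sigma, Finset.mem_powersetCard, Finset.subset_erase] at h
      simp [Finset.erase_insert h.2.1.2]
    · rintro ⟨I, i⟩ h
      simp only [Finset.mem_sigma] at h
      simp [Finset.insert_erase h.2]
    · rintro ⟨i, J⟩ h
      simp only [Finset.mem_sigma, Finset.mem_powersetCard, Finset.subset_erase] at h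
      obtain ⟨hi, ⟨hJ, hiJ⟩, -⟩ := h
      have h1 : S.erase i \ J = S \ insert i J := by
        ext j
        simp only [Finset.mem_sdiff, Finset.mem_erase, Finset.mem_insert]
        tauto
      have h2 : S.erase i = (S \ insert i J) ∪ J := by
        ext j
        simp only [Finset.mem_sdiff, Finset.mem_erase, Finset.mem_insert, Finset.mem_union]
        have := @hJ j
        by_cases hj : j ∈ J
        · have : j ≠ i := fun h => hiJ (h ▸ hj)
          tauto
        · tauto
      have h3 : Disjoint (S \ insert i J) J := by
        rw [Finset.disjoint_left]
        intro j hj hj'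
        simp [hj'] at hj
      simp only [h1, Finset.erase_insert hiJ, Finset.prod_insert hiJ]
      -- The factors of the first column over `S \ I` supply the cross factors of `i` and one extra
      -- empty column; those over `J` belong to the staircase in `I`.
      rw [h2, Finset.prod_union h3, Finset.prod_mul_distrib (s := S \ insert i J)]
      ring

end

/-! ### Freezing at the spectral parameter s -/

section

variable {ι : Type*} {u : ι → ℂ}

lemma replicate_append_fullRows (k : ℕ) (S : Finset ι) :
    List.replicate k (s, 1) ++ fullRows u S =
      (List.replicate k s ++ S.toList.map u).map fun w => (w, 1) := by
  simp [fullRows, Function.comp_def]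

/-- The weight of going straight in the bottom row is proportional to s - s = 0, so that path turns
up. The top multiplicity being one, all others go straight over one vertical path, and the emptied
row drops out. -/
lemma rowZ_one_append_fullRows (hs : s ^ 2 ≠ 1) (k : ℕ) (S : Finset ι) (es : List ℕ) :
    rowZ s q (1 :: es) (List.replicate (k + 1) (s, 1) ++ fullRows u S) =
      (1 - q) * (1 - s ^ 2)⁻¹ * ((s - s * q) * (1 - s ^ 2)⁻¹) ^ k *
      (∏ i ∈ S, (u i - s * q) * (1 - s * u i)⁻¹) *
      rowZ s q es (List.replicate k (s, 1) ++ fullRows u S) := by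
  have h : column s q (List.replicate k (s, 1) ++ fullRows u S) 1 1
        (fun r => rowZ s q es ((s, 0) :: r)) =
      ((s - s * q) * (1 - s ^ 2)⁻¹) ^ k * (∏ i ∈ S, (u i - s * q) * (1 - s * u i)⁻¹) *
      rowZ s q es (List.replicate k (s, 1) ++ fullRows u S) := by
    rw [replicate_append_fullRows, column_full_self (fun w => w), rowZ_zero_cons (by rwa [← pow_two])]
    simp [Finset.prod_map_toList, Function.comp_def, pow_two]
  rw [List.replicate_succ, List.cons_append, rowZ, column_one, zero_add, h]
  ring

lemma rowZ_zero_append_fullRows (k : ℕ) (S : Finset ι) (es : List ℕ) :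
    rowZ s q (0 :: es) (List.replicate (k + 1) (s, 1) ++ fullRows u S) = 0 := by
  rw [replicate_append_fullRows, rowZ, column_full_self (fun w => w)]
  simp [List.replicate_succ]

lemma rowZ_replicate_succ (hs : s ^ 2 ≠ 1) (k : ℕ) :
    rowZ s q (List.replicate (k + 1) 1) (List.replicate (k + 1) (s, 1)) =
      (1 - q) * (1 - s ^ 2)⁻¹ * ((s - s * q) * (1 - s ^ 2)⁻¹) ^ k *
      rowZ s q (List.replicate k 1) (List.replicate k (s, 1)) := by
  -- The parameters are irrelevant, since the index set is empty.
  have h := rowZ_one_append_fullRows (q := q) (u := fun i : ℕ => (0 : ℂ)) hs k ∅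
    (List.replicate k 1)
  simpa [fullRows, ← List.replicate_succ] using h

/-- The normalization F_k(S) is a product of factors 1 - q, (1 - s²)⁻¹ and s(1 - q); the last kind
is absent for `k ≤ 1`, so s = 0 is allowed there. -/
lemma rowZ_replicate_ne_zero (hs : s ^ 2 ≠ 1) (hq : q ≠ 1) (k : ℕ) (hk : s ≠ 0 ∨ k ≤ 1) :
    rowZ s q (List.replicate k 1) (List.replicate k (s, 1)) ≠ 0 := by
  induction k with
  | zero => simp [rowZ]
  | succ k ih =>
    rw [rowZ_replicate_succ hs]
    have h1 : 1 - q ≠ 0 := sub_ne_zero.2 hq.symm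
    have h2 : 1 - s ^ 2 ≠ 0 := sub_ne_zero.2 hs.symm
    refine mul_ne_zero (mul_ne_zero (mul_ne_zero h1 (inv_ne_zero h2)) ?_)
      (ih (hk.imp_right fun h => by omega))
    rcases hk with hs0 | hk
    · refine pow_ne_zero _ (mul_ne_zero ?_ (inv_ne_zero h2))
      rw [show s - s * q = s * (1 - q) by ring]
      exact mul_ne_zero hs0 h1
    · obtain rfl : k = 0 := by omega
      simp

lemma rowZ_replicate_append_fullRows (hs : s ^ 2 ≠ 1) (k : ℕ) (S : Finset ι) (es : List ℕ) :
    rowZ s q (List.replicate k 1 ++ es) (List.replicate k (s, 1) ++ fullRows u S) =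
      rowZ s q (List.replicate k 1) (List.replicate k (s, 1)) *
      (∏ i ∈ S, ((u i - s * q) * (1 - s * u i)⁻¹) ^ k) * rowZ s q es (fullRows u S) := by
  induction k with
  | zero => simp [rowZ]
  | succ k ih =>
    rw [rowZ_replicate_succ hs]
    simp only [List.replicate_succ (a := 1), List.cons_append]
    rw [rowZ_one_append_fullRows hs, ih]
    simp only [pow_succ, Finset.prod_mul_distrib]
    ring

/-- If `k` of the variables are equal to `s` and no part is repeated, the smallest `k` parts have
to form a staircase. -/
lemma rowZ_append_fullRows_eq_zero (hs : s ^ 2 ≠ 1) (S : Finset ι) (es es' : List ℕ)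
    (hes : ∀ e ∈ es, e ≤ 1) (hne : ∃ e ∈ es, e ≠ 1) :
    rowZ s q (es ++ es') (List.replicate es.length (s, 1) ++ fullRows u S) = 0 := by
  induction es with
  | nil => simp at hne
  | cons e es ih =>
    rw [List.cons_append, List.length_cons]
    have he := hes e List.mem_cons_self
    -- Multiplicity zero lets the bottom s-row go straight, with weight zero; multiplicity one uses
    -- up one column and one s-row.
    interval_cases e
    · exact rowZ_zero_append_fullRows _ _ _
    · rw [rowZ_one_append_fullRows hs, ih (fun e he => hes e (List.mem_cons_of_mem _ he))
        (by simpa using hne), mul_zero]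

end

/-! ### The staircase condition and reordering of variables -/

lemma mult_le_one {n : ℕ} {lam : Fin n → ℕ} (h : Function.Injective lam) (x : ℕ) :
    mult lam x ≤ 1 := by
  rw [mult, Finset.card_le_one]
  intro i hi j hj
  simp only [Finset.mem_filter, Finset.mem_univ, true_and] at hi hj
  exact h (hi.trans hj.symm)

lemma mult_eq_one_iff {n : ℕ} {lam : Fin n → ℕ} (h : Function.Injective lam) (x : ℕ) :
    mult lam x = 1 ↔ ∃ i, lam i = x := by
  rw [← (mult_le_one h x).ge_iff_eq, mult, Nat.one_le_iff_ne_zero, Finset.card_ne_zero]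
  simp [Finset.filter_nonempty_iff]

lemma forall_mult_eq_one_iff {m k : ℕ} (hkm : k ≤ m) {lam : Fin m → ℕ} (hlam : StrictAnti lam) :
    (∀ x < k, mult lam x = 1) ↔ ∀ r : Fin m, (r : ℕ) < k → lam r.rev = r := by
  simp only [mult_eq_one_iff hlam.injective]
  refine ⟨fun h => ?_, fun h x hx => ⟨_, h ⟨x, by omega⟩ hx⟩⟩
  suffices ∀ x (hx : x < m), x < k → lam (Fin.rev ⟨x, hx⟩) = x from fun r hr => this r r.2 hr
  intro x
  induction x using Nat.strong_induction_on with
  | _ x ih =>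
    intro hx hxk
    obtain ⟨i, hi⟩ := h x hxk
    -- If x occurred at another position, then either an earlier case already fixes a different
    -- value there, or monotonicity makes the part at position x smaller than x, a value already
    -- taken.
    rcases lt_trichotomy (Fin.rev i : ℕ) x with hlt | heq | hgt
    · have := ih _ hlt (Fin.rev i).2 (hlt.trans hxk)
      rw [Fin.eta, Fin.rev_rev, hi] at this
      omega
    · have : Fin.rev ⟨x, hx⟩ = i := by rw [← Fin.rev_rev i]; congr 1; exact Fin.ext heq.symm
      rw [this, hi]
    · have h1 : i < Fin.rev ⟨x, hx⟩ := by rw [← Fin.lt_rev_iff]; exact hgt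
      have h2 := hlam h1
      rw [hi] at h2
      have h3 := ih _ h2 (h2.trans hx) (h2.trans hxk)
      have h4 := congrArg Fin.val (Fin.rev_injective (hlam.injective h3))
      simp only at h4
      omega

lemma Fstair_eq_rowZ {k : ℕ} {u : Fin k → ℂ} (hu : ∀ i, s * u i ≠ 1) :
    Fstair s q k u = rowZ s q (List.replicate k 1) (List.ofFn fun y => (u y, 1)) := by
  have hinj : Function.Injective fun i : Fin k => (i.rev : ℕ) :=
    Fin.val_injective.comp Fin.rev_injective
  have h : ∀ x : Fin k, mult (fun i : Fin k => (i.rev : ℕ)) x = 1 := fun x =>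
    (mult_eq_one_iff hinj _).2 ⟨x.rev, by simp⟩
  rw [Fstair, F_eq_rowZ _ hu (L := k) fun i => i.rev.2]
  simp only [h, List.ofFn_const]

section

variable {m : ℕ} (u : Fin m → ℂ)

lemma Exchange.ofFn_orderEmb {K : List (ℂ × ℕ) → ℂ} (hK : Exchange q K) (I : Finset (Fin m)) :
    K (List.ofFn fun a => (u (I.orderEmbOfFin rfl a), 1)) = K (fullRows u I) := by
  have h : (List.ofFn (I.orderEmbOfFin rfl)).Perm I.toList := by
    rw [List.perm_ext_iff_of_nodup (List.nodup_ofFn.2 (I.orderEmbOfFin rfl).injective)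
      I.nodup_toList]
    intro i
    rw [List.mem_ofFn', Finset.range_orderEmbOfFin, Finset.mem_toList, Finset.mem_coe]
  have h' := hK.perm u h
  rwa [List.map_ofFn] at h'

lemma Exchange.ofFn_piecewise {K : List (ℂ × ℕ) → ℂ} (hK : Exchange q K) (c : ℂ)
    (I : Finset (Fin m)) :
    K (List.ofFn fun y => (I.piecewise (fun _ => c) u y, 1)) =
      K (List.replicate I.card (c, 1) ++ fullRows u Iᶜ) := by
  have h : (List.ofFn (id : Fin m → Fin m)).Perm (I.toList ++ Iᶜ.toList) := by
    rw [List.perm_ext_iff_of_nodup (List.nodup_ofFn.2 Function.injective_id)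
      (I.nodup_toList.append Iᶜ.nodup_toList fun i hi hi' => by simp_all)]
    intro i
    simp [List.mem_ofFn', em]
  have h' := hK.perm (I.piecewise (fun _ => c) u) h
  rw [List.map_ofFn, List.map_append] at h'
  refine h'.trans (congrArg K (congrArg₂ _ ?_ ?_))
  · rw [List.eq_replicate_iff]
    simp +contextual
  · refine List.map_congr_left fun i hi => ?_
    rw [Finset.mem_toList, Finset.mem_compl] at hi
    rw [Finset.piecewise_eq_of_notMem _ _ _ hi]

end

end SixVertex

end

/-! ### Comparison of the two evaluations -/

open SixVertex in
theorem lemma3p3 (m k : ℕ) (hk : 1 ≤ k) (hkm : k ≤ m)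
    (s q : ℂ) (hs2 : s ^ 2 ≠ 1) (hq : q ≠ 1) (hs : s ≠ 0 ∨ k = 1)
    (lam : Fin m → ℕ) (hlam : StrictAnti lam)
    (u : Fin m → ℂ) (hu : Function.Injective u) (hsu : ∀ i, s * u i ≠ 1)
    (husq : k < m → ∀ j, u j ≠ s * q) :
    SixVertex.D s q m k (SixVertex.F s q lam) u =
      if ∀ r : Fin m, (r : ℕ) < k → lam r.rev = r then SixVertex.F s q lam u else 0 := by
  obtain ⟨N, hN⟩ : ∃ N, ∀ i, lam i < N :=
    ⟨∑ i, lam i + 1, fun i => Nat.lt_succ_of_le (Finset.single_le_sum (fun _ _ => Nat.zero_le _)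
      (Finset.mem_univ i))⟩
  have hss : s * s ≠ 1 := by rwa [← pow_two]
  have hes : (List.ofFn fun x : Fin (k + N) => mult lam x) =
      (List.ofFn fun x : Fin k => mult lam x) ++ List.ofFn fun x : Fin N => mult lam (k + x) := by
    rw [List.ofFn_add]; rfl
  have hF : ∀ w : Fin m → ℂ, (∀ i, s * w i ≠ 1) → F s q lam w =
      rowZ s q ((List.ofFn fun x : Fin k => mult lam x) ++
        List.ofFn fun x : Fin N => mult lam (k + x)) (List.ofFn fun y => (w y, 1)) := by
    intro w hw
    rw [F_eq_rowZ lam hw (L := k + N) fun i => (hN i).trans_le (Nat.le_add_left _ _), hes]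
  have hpw : ∀ I : Finset (Fin m), F s q lam (I.piecewise (fun _ => s) u) =
      rowZ s q ((List.ofFn fun x : Fin k => mult lam x) ++
        List.ofFn fun x : Fin N => mult lam (k + x))
        (List.replicate I.card (s, 1) ++ fullRows u Iᶜ) := by
    intro I
    rw [hF, (exchange_rowZ _).ofFn_piecewise]
    intro i
    by_cases hi : i ∈ I <;> simp [hi, hss, hsu]
  unfold D
  split_ifs with hcond
  · have h1 := (forall_mult_eq_one_iff hkm hlam).2 hcond
    have h2 : (List.ofFn fun x : Fin k => mult lam x) = List.replicate k 1 := by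
      simp only [h1 _ (Fin.is_lt _), List.ofFn_const]
    have h3 : F s q lam u = rowZ s q (List.replicate k 1 ++
        List.ofFn fun x : Fin N => mult lam (k + x)) (fullRows u Finset.univ) := by
      -- With no variable replaced, this only reorders the rows.
      have := hpw ∅
      simpa [h2] using this
    rw [h3, rowZ_replicate_one_append hu hsu]
    refine Finset.sum_congr rfl fun I hI => ?_
    obtain ⟨-, hI⟩ := Finset.mem_powersetCard.1 hI
    have hC := rowZ_replicate_ne_zero hs2 hq k (hs.imp_right fun h => h.le)
    have h4 : (∏ j ∈ Iᶜ, ((u j - s) / (u j - s * q)) ^ k) *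
        (∏ j ∈ Iᶜ, ((u j - s * q) * (1 - s * u j)⁻¹) ^ k) =
        ∏ j ∈ Iᶜ, ((u j - s) * (1 - s * u j)⁻¹) ^ k := by
      rw [← Finset.prod_mul_distrib]
      refine Finset.prod_congr rfl fun j hj => ?_
      -- A factor over `Iᶜ` exists only if `k < m`, exactly when u_j ≠ s q is assumed.
      have hlt : k < m := by
        have := Finset.card_pos.2 ⟨j, hj⟩
        rw [Finset.card_compl, Fintype.card_fin, hI] at this
        omega
      have := sub_ne_zero.2 (husq hlt j)
      rw [← mul_pow, ← mul_assoc, div_mul_cancel₀ _ this]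
    rw [hpw, h2, Fstair_eq_rowZ fun a => hsu _, (exchange_rowZ _).ofFn_orderEmb,
      Fstair_eq_rowZ fun _ => hss, List.ofFn_const, hI, rowZ_replicate_append_fullRows hs2,
      ← Finset.compl_eq_univ_sdiff, rowZ_replicate_zero_fullRows, ← h4]
    field_simp
  · rw [← forall_mult_eq_one_iff hkm hlam] at hcond
    push Not at hcond
    obtain ⟨x, hx, hx1⟩ := hcond
    -- One of the first `k` multiplicities is not one, so each term vanishes separately.
    refine Finset.sum_eq_zero fun I hI => ?_
    obtain ⟨-, hI⟩ := Finset.mem_powersetCard.1 hI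
    have := rowZ_append_fullRows_eq_zero (q := q) (u := u) hs2 Iᶜ
      (List.ofFn fun x : Fin k => mult lam x) (List.ofFn fun x : Fin N => mult lam (k + x))
      (fun e he => by
        obtain ⟨y, rfl⟩ := (List.mem_ofFn' _ _).1 he
        exact mult_le_one hlam.injective _)
      ⟨_, (List.mem_ofFn' _ _).2 ⟨⟨x, hx⟩, rfl⟩, hx1⟩
    rw [List.length_ofFn] at this
    rw [hpw, show List.replicate I.card (s, 1) = _ from congrArg (List.replicate · _) hI, this, mul_zero]
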